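/- Let $m\ge 2$, let $\overline M$ be a smooth Riemannian manifold of dimension $m+1$ with metric $\langle\cdot,\cdot\rangle$ and Levi-Civita connection $\overline\nabla$, and let $M$ be a hypersurface of $\overline M$, that is, a smooth $m$-dimensional Riemannian manifold with an isometric immersion $\iota:M\to\overline M$. Let $\nabla$ be the Levi-Civita connection of $M$ and $\eta$ a unit normal vector field along $M$. Write $B(V,W)=\overline\nabla_V W-\nabla_V W$ for the second fundamental form, and let $A:TM\to TM$ be the Weingarten operator, $\langle A(V),W\rangle=\langle\eta,B(V,W)\rangle$. Let $\overline X:M\to T\overline M$ be a vector field along $M$ of class $C^1$ (so $\overline X(p)\in T_{\iota(p)}\overline M$), with tangential part $X^\top$; let $T:TM\to TM$ be a field of symmetric linear operators of class $C^1$; and let $f:M\to\mathbb R$ be a function of class $C^1$. Then, at every point of $M$, $$ \operatorname{div}_f\big(T(X^\top)\big) = -\langle X^\top, T(\nabla f)\rangle + \operatorname{tr}\Big(E\mapsto T\big((\overline\nabla_E\overline X)^\top\big)\Big) + \langle\overline X,\eta\rangle\,\operatorname{tr}(AT) + (\operatorname{div}T)(X^\top). $$ Here $\operatorname{div}Y=\operatorname{tr}(E\mapsto\nabla_E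 Y)$ for a vector field $Y$ on $M$, $\operatorname{div}_f(Y)=e^{f}\operatorname{div}(e^{-f}Y)$ is the weighted divergence, $(\nabla_E T)(Y)=\nabla_E(T(Y))-T(\nabla_E Y)$, $(\operatorname{div}T)(Y)=\operatorname{tr}(E\mapsto(\nabla_E T)(Y))$, $\nabla f$ is the gradient of $f$ on $M$, and $\operatorname{tr}$ is the trace of an operator on the tangent space of $M$. -/

import Mathlib

open Bundle Manifold
open scoped ContDiff InnerProductSpace

noncomputable section

namespace HypersurfaceDiv

section TangentSpace

variable {E : Type*} [NormedAddCommGroup E] [NormedSpace ℝ E] [FiniteDimensional ℝ E]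
  {H : Type*} [TopologicalSpace H] (I : ModelWithCorners ℝ E H)
  {M : Type*} [TopologicalSpace M] [ChartedSpace H M]

instance instFiniteDimensionalTangentSpace (p : M) :
    FiniteDimensional ℝ (TangentSpace I p) :=
  inferInstanceAs (FiniteDimensional ℝ E)

end TangentSpace

/-- The vector representing a linear functional on a finite-dimensional inner product space:
`⟪sharp ℓ, w⟫ = ℓ w`. -/
def sharp {V : Type*} [NormedAddCommGroup V] [InnerProductSpace ℝ V] [FiniteDimensional ℝ V] :
    (V →ₗ[ℝ] ℝ) →ₗ[ℝ] V :=
  letI : CompleteSpace V := FiniteDimensional.complete ℝ V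
  { toFun := fun ℓ => (InnerProductSpace.toDual ℝ V).symm (LinearMap.toContinuousLinearMap ℓ)
    map_add' := by intro a b; simp
    map_smul' := by intro c a; simp }

theorem inner_sharp {V : Type*} [NormedAddCommGroup V] [InnerProductSpace ℝ V]
    [FiniteDimensional ℝ V] (ℓ : V →ₗ[ℝ] ℝ) (w : V) : ⟪sharp ℓ, w⟫_ℝ = ℓ w := by
  let : CompleteSpace V := FiniteDimensional.complete ℝ V
  exact InnerProductSpace.toDual_symm_apply

set_option linter.unusedSectionVars false

section Connection

variable {E : Type*} [NormedAddCommGroup E] [NormedSpace ℝ E] [FiniteDimensional ℝ E]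
  {H : Type*} [TopologicalSpace H] (I : ModelWithCorners ℝ E H)
  {M : Type*} [TopologicalSpace M] [ChartedSpace H M] [IsManifold I ∞ M]
  [RiemannianBundle (fun x : M => TangentSpace I x)]
  {E' : Type*} [NormedAddCommGroup E'] [NormedSpace ℝ E']
  {H' : Type*} [TopologicalSpace H'] (J : ModelWithCorners ℝ E' H')
  {N : Type*} [TopologicalSpace N] [ChartedSpace H' N]

/-- The vector of components of `v ∈ T_q M` in the coordinate frame of the chart at `p`. -/
def comps (p q : M) : TangentSpace I q →L[ℝ] E :=
  (trivializationAt E (TangentSpace I : M → Type _) p).continuousLinearMapAt ℝ q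

/-- The tangent vector at `q` with given components in the coordinate frame of the chart
at `p`. -/
def ofComps (p q : M) : E →L[ℝ] TangentSpace I q :=
  (trivializationAt E (TangentSpace I : M → Type _) p).symmL ℝ q

/-- The vector field extending `w ∈ T_p M` with constant components in the chart at `p`. -/
def constExt (p : M) (w : TangentSpace I p) (q : M) : TangentSpace I q :=
  ofComps I p q (comps I p p w)

/-- The metric coefficients `g_{ij}` at the point `q`, in the coordinate frame of the chart
at `p`, as a bilinear form on the model space. -/
def metricCoeff (p q : M) : E →L[ℝ] E →L[ℝ] ℝ :=
  (innerSL ℝ (E := TangentSpace I q)).bilinearComp (ofComps I p q) (ofComps I p q)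

/-- The derivative at `p` in the direction `u` of the metric coefficients in the chart at `p`,
that is `u ⟪V, W⟫`, where `V = constExt I p v`, `W = constExt I p w`. -/
def dMetric (p : M) (u v w : TangentSpace I p) : ℝ :=
  mvfderiv I (metricCoeff I p) p u (comps I p p v) (comps I p p w)

theorem dMetric_add_left (p : M) (a b v w : TangentSpace I p) :
    dMetric I p (a + b) v w = dMetric I p a v w + dMetric I p b v w := by
  simp only [dMetric, ContinuousLinearMap.map_add, add_apply]

theorem dMetric_smul_left (p : M) (c : ℝ) (a v w : TangentSpace I p) :
    dMetric I p (c • a) v w = c * dMetric I p a v w := by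
  simp only [dMetric, ContinuousLinearMap.map_smul, smul_apply, smul_eq_mul]

theorem dMetric_add_mid (p : M) (u a b w : TangentSpace I p) :
    dMetric I p u (a + b) w = dMetric I p u a w + dMetric I p u b w := by
  simp only [dMetric, ContinuousLinearMap.map_add, add_apply]

theorem dMetric_smul_mid (p : M) (c : ℝ) (u a w : TangentSpace I p) :
    dMetric I p u (c • a) w = c * dMetric I p u a w := by
  simp only [dMetric, ContinuousLinearMap.map_smul, smul_apply, smul_eq_mul]

theorem dMetric_add_right (p : M) (u v a b : TangentSpace I p) :
    dMetric I p u v (a + b) = dMetric I p u v a + dMetric I p u v b := by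
  simp only [dMetric, ContinuousLinearMap.map_add]

theorem dMetric_smul_right (p : M) (c : ℝ) (u v a : TangentSpace I p) :
    dMetric I p u v (c • a) = c * dMetric I p u v a := by
  simp only [dMetric, ContinuousLinearMap.map_smul, smul_eq_mul]

/-- The Christoffel symbols of the first kind at `p`, in the chart at `p`:
`Γ(u, v, w) = (∂_u g(v, w) + ∂_v g(u, w) - ∂_w g(u, v)) / 2`. -/
def christoffelFirst (p : M) (u v : TangentSpace I p) : TangentSpace I p →ₗ[ℝ] ℝ where
  toFun w := (dMetric I p u v w + dMetric I p v u w - dMetric I p w u v) / 2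
  map_add' a b := by rw [dMetric_add_right, dMetric_add_right, dMetric_add_left]; ring
  map_smul' c a := by
    rw [dMetric_smul_right, dMetric_smul_right, dMetric_smul_left, RingHom.id_apply, smul_eq_mul]
    ring

/-- The Christoffel symbols (of the second kind) of the Levi-Civita connection at `p`, in the
chart at `p`, as a map linear in the direction of differentiation `u`. -/
def christoffel (p : M) (v : TangentSpace I p) : TangentSpace I p →ₗ[ℝ] TangentSpace I p where
  toFun u := sharp (christoffelFirst I p u v)
  map_add' a b := by
    rw [← map_add]
    congr 1
    ext w
    simp only [christoffelFirst, LinearMap.coe_mk, AddHom.coe_mk, LinearMap.add_apply]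
    rw [dMetric_add_left, dMetric_add_mid, dMetric_add_mid]
    ring
  map_smul' c a := by
    rw [RingHom.id_apply, ← map_smul]
    congr 1
    ext w
    simp only [christoffelFirst, LinearMap.coe_mk, AddHom.coe_mk, LinearMap.smul_apply]
    rw [dMetric_smul_left, dMetric_smul_mid, dMetric_smul_mid, smul_eq_mul]
    ring

/-- The covariant derivative `e ↦ ∇_e X` at `p ∈ N` of a vector field `X` along a map `F : N → M`,
i.e. `X q ∈ T_{F q} M`, for the Levi-Civita connection of the Riemannian manifold `M`: in the chart
of `M` at `F p` it is `d(X^k)(e) + Γ^k_{ij} dF^i(e) X^j`. -/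
def covAlong (F : N → M) (X : ∀ q : N, TangentSpace I (F q)) (p : N) :
    TangentSpace J p →ₗ[ℝ] TangentSpace I (F p) :=
  (ofComps I (F p) (F p)).toLinearMap ∘ₗ
      (mvfderiv J (fun q => comps I (F p) (F q) (X q)) p).toLinearMap
    + christoffel I (F p) (X p) ∘ₗ (mfderiv J I F p).toLinearMap

/-- The Levi-Civita covariant derivative `e ↦ ∇_e Y` at `p` of a vector field `Y` on `M`. -/
def cov (Y : ∀ q : M, TangentSpace I q) (p : M) : TangentSpace I p →ₗ[ℝ] TangentSpace I p :=
  covAlong I I (fun q : M => q) Y p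

/-- The divergence `div Y = tr (E ↦ ∇_E Y)`. -/
def divergence (Y : ∀ q : M, TangentSpace I q) (p : M) : ℝ :=
  LinearMap.trace ℝ (TangentSpace I p) (cov I Y p)

/-- The weighted divergence `div_f Y = e^f div (e^{-f} Y)`. -/
def weightedDivergence (f : M → ℝ) (Y : ∀ q : M, TangentSpace I q) (p : M) : ℝ :=
  Real.exp (f p) * divergence I (fun q => Real.exp (-f q) • Y q) p

/-- The gradient of a function. -/
def grad (f : M → ℝ) (p : M) : TangentSpace I p :=
  sharp (mvfderiv I f p).toLinearMap

/-- The covariant derivative of a field of endomorphisms,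
`E ↦ (∇_E T)(Y) = ∇_E (T Y) - T (∇_E Y)`. -/
def covEnd (T : ∀ q : M, TangentSpace I q →L[ℝ] TangentSpace I q)
    (Y : ∀ q : M, TangentSpace I q) (p : M) : TangentSpace I p →ₗ[ℝ] TangentSpace I p :=
  cov I (fun q => T q (Y q)) p - (T p).toLinearMap ∘ₗ cov I Y p

/-- The divergence of a field of endomorphisms, `(div T)(Y) = tr (E ↦ (∇_E T)(Y))`. -/
def divEnd (T : ∀ q : M, TangentSpace I q →L[ℝ] TangentSpace I q)
    (Y : ∀ q : M, TangentSpace I q) (p : M) : ℝ :=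
  LinearMap.trace ℝ (TangentSpace I p) (covEnd I T Y p)

end Connection

section Immersion

variable {E : Type*} [NormedAddCommGroup E] [NormedSpace ℝ E] [FiniteDimensional ℝ E]
  {H : Type*} [TopologicalSpace H] (I : ModelWithCorners ℝ E H)
  {M : Type*} [TopologicalSpace M] [ChartedSpace H M] [IsManifold I ∞ M]
  [RiemannianBundle (fun x : M => TangentSpace I x)]
  {E' : Type*} [NormedAddCommGroup E'] [NormedSpace ℝ E'] [FiniteDimensional ℝ E']
  {H' : Type*} [TopologicalSpace H'] (I' : ModelWithCorners ℝ E' H')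
  {M' : Type*} [TopologicalSpace M'] [ChartedSpace H' M'] [IsManifold I' ∞ M']
  [RiemannianBundle (fun x : M' => TangentSpace I' x)]

/-- A smooth map whose differential preserves the Riemannian metrics. -/
structure IsIsometricImmersion (ι : M → M') : Prop where
  contMDiff : ContMDiff I I' ∞ ι
  inner_mfderiv : ∀ (p : M) (u v : TangentSpace I p),
    ⟪mfderiv I I' ι p u, mfderiv I I' ι p v⟫_ℝ = ⟪u, v⟫_ℝ

/-- The tangential part `X^⊤ ∈ T_p M` of `X ∈ T_{ι p} M'`, for an isometric immersion `ι`: the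
adjoint of `dι_p`. -/
def tangential (ι : M → M') (p : M) : TangentSpace I' (ι p) →ₗ[ℝ] TangentSpace I p :=
  LinearMap.adjoint (mfderiv I I' ι p).toLinearMap


/-- `X - dι(X^⊤)` is normal. -/
theorem IsIsometricImmersion.inner_sub_tangential {ι : M → M'}
    (hι : IsIsometricImmersion I I' ι) (p : M) (X : TangentSpace I' (ι p)) (v : TangentSpace I p) :
    ⟪X - mfderiv I I' ι p (tangential I I' ι p X), mfderiv I I' ι p v⟫_ℝ = 0 := by
  rw [inner_sub_left, hι.inner_mfderiv, tangential, LinearMap.adjoint_inner_left]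
  exact sub_self _

/-- The second fundamental form `B(v, w) = ∇'_v W - ∇_v W` at `p`, where the vector field
`W` is the extension of `w` with constant components in the chart at `p`, as a map linear in `v`. -/
def secondFundamentalForm (ι : M → M') (p : M) (w : TangentSpace I p) :
    TangentSpace I p →ₗ[ℝ] TangentSpace I' (ι p) :=
  covAlong I' I ι (fun q => mfderiv I I' ι q (constExt I p w q)) p
    - (mfderiv I I' ι p).toLinearMap ∘ₗ cov I (constExt I p w) p

/-- The Weingarten operator `A` of the immersion with respect to a normal vector `ν` at `p`,
given by `⟪A v, w⟫ = ⟪ν, B(v, w)⟫`, written out in an orthonormal basis of `T_p M`. -/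
def weingarten (ι : M → M') (p : M) (ν : TangentSpace I' (ι p)) :
    TangentSpace I p →ₗ[ℝ] TangentSpace I p :=
  ∑ i, (((innerSL ℝ ν).toLinearMap ∘ₗ
      secondFundamentalForm I I' ι p (stdOrthonormalBasis ℝ (TangentSpace I p) i)).smulRight
    (stdOrthonormalBasis ℝ (TangentSpace I p) i))

end Immersion

end HypersurfaceDiv

end

/-!
Write `Y = X^⊤`. By the definition of `div T`, `div (T Y) = (div T)(Y) + tr (T ∘ ∇Y)`, and
`div_f Z = div Z - ⟪∇f, Z⟫` (`weightedDivergence_eq`), so with the symmetry of `T` the theorem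
reduces to the pointwise formula

`∇_v X^⊤ = (∇'_v X)^⊤ + ⟪X, η⟫ A v`  (`IsIsometricImmersion.cov_tangential`),

which is composed with `T` and traced.

To prove this formula, the identity `⟪X^⊤, W⟫ = ⟪X, dι W⟫` is differentiated for a coordinate vector
field `W`, using that the connections of `M` and `M'` are compatible with the metrics, in the
form needed for fields along a map (`mvfderiv_inner_along`). This gives
`⟪∇_v X^⊤, W⟫ = ⟪(∇'_v X)^⊤, W⟫ + ⟪X, B(v, W)⟫`. The second fundamental form takes normal
values (`IsIsometricImmersion.inner_secondFundamentalForm`), and in codimension one this means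
`B = ⟪η, B⟫ η`.

That `B` is normal is Gauss' formula. The trilinear form `⟪B(v, w), dι u⟫` is symmetric in `v, w`,
because both connections are torsion free and second partial derivatives commute
(`mvfderiv_comps_mfderiv_constExt_symm`), and skew in `w, u`, because both connections are
metric and `ι` is isometric; hence it vanishes.

Throughout, a vector field along a map is differentiable when it is so as a map to the tangent
bundle, which is equivalent to the differentiability of its components in a chart
(`mdifferentiableAt_along_iff`).
-/

namespace HypersurfaceDiv

/-! ### Families of continuous linear maps on a manifold -/

section Calculus

variable {E' : Type*} [NormedAddCommGroup E'] [NormedSpace ℝ E']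
  {H' : Type*} [TopologicalSpace H'] {J : ModelWithCorners ℝ E' H'}
  {N : Type*} [TopologicalSpace N] [ChartedSpace H' N]
  {F : Type*} [NormedAddCommGroup F] [NormedSpace ℝ F]
  {G : Type*} [NormedAddCommGroup G] [NormedSpace ℝ G]

/-- The Leibniz rule for the evaluation of a family of linear maps on a family of vectors. -/
theorem mvfderiv_clm_apply {c : N → F →L[ℝ] G} {u : N → F} {p : N}
    (hc : MDifferentiableAt J 𝓘(ℝ, F →L[ℝ] G) c p) (hu : MDifferentiableAt J 𝓘(ℝ, F) u p)
    (v : TangentSpace J p) :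
    mvfderiv J (fun q => c q (u q)) p v = mvfderiv J c p v (u p) + c p (mvfderiv J u p v) := by
  have hs : UniqueDiffWithinAt ℝ (Set.range J) (extChartAt J p p) :=
    J.uniqueDiffOn _ (Set.mem_range_self _)
  have hc' : DifferentiableWithinAt ℝ (c ∘ (extChartAt J p).symm)
    (Set.range J) (extChartAt J p p) := ((mdifferentiableAt_iff _ _).1 hc).2
  have hu' : DifferentiableWithinAt ℝ (u ∘ (extChartAt J p).symm)
    (Set.range J) (extChartAt J p p) := ((mdifferentiableAt_iff _ _).1 hu).2
  have h := congr($(fderivWithin_clm_apply hs hc' hu') v)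
  rw [(hc.clm_apply hu).mvfderiv, hc.mvfderiv, hu.mvfderiv, add_comm]
  simp only [Function.comp_apply, extChartAt_to_inv] at h
  exact h

/-- On a finite-dimensional source, differentiability of a family of continuous linear maps
can be tested pointwise. -/
theorem mdifferentiableAt_clm_of_apply [FiniteDimensional ℝ F] [FiniteDimensional ℝ G]
    {c : N → F →L[ℝ] G} {p : N}
    (hc : ∀ e, MDifferentiableAt J 𝓘(ℝ, G) (fun q => c q e) p) :
    MDifferentiableAt J 𝓘(ℝ, F →L[ℝ] G) c p := by
  let b := Module.finBasis ℝ F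
  let L : (Fin (Module.finrank ℝ F) → G) →L[ℝ] (F →L[ℝ] G) := LinearMap.toContinuousLinearMap
    ((LinearMap.toContinuousLinearMap (E := F) (F' := G)).toLinearMap ∘ₗ
      (b.constr ℝ).toLinearMap)
  have h : c = L ∘ fun q i => c q (b i) := by
    funext q
    refine ContinuousLinearMap.coe_injective (b.ext fun i => ?_)
    simp [L]
  rw [h]
  refine L.differentiableAt.comp_mdifferentiableAt
    ((mdifferentiableAt_iff _ _).2 ⟨continuousAt_pi.2 fun i => (hc (b i)).continuousAt, ?_⟩)
  exact differentiableWithinAt_pi.2 fun i => ((mdifferentiableAt_iff _ _).1 (hc (b i))).2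

end Calculus

/-! ### The Levi-Civita connection in coordinates -/

section Connection

variable {E : Type*} [NormedAddCommGroup E] [NormedSpace ℝ E]
  {H : Type*} [TopologicalSpace H] {I : ModelWithCorners ℝ E H}
  {M : Type*} [TopologicalSpace M] [ChartedSpace H M] [IsManifold I ∞ M]
  {E' : Type*} [NormedAddCommGroup E'] [NormedSpace ℝ E']
  {H' : Type*} [TopologicalSpace H'] {J : ModelWithCorners ℝ E' H'}
  {N : Type*} [TopologicalSpace N] [ChartedSpace H' N]

theorem ofComps_comps {p q : M} (hq : q ∈ (chartAt H p).source) (v : TangentSpace I q) :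
    ofComps I p q (comps I p q v) = v :=
  (trivializationAt E (TangentSpace I : M → Type _) p).symmL_continuousLinearMapAt (R := ℝ)
    (by simpa using hq) v

theorem comps_ofComps {p q : M} (hq : q ∈ (chartAt H p).source) (e : E) :
    comps I p q (ofComps I p q e) = e :=
  (trivializationAt E (TangentSpace I : M → Type _) p).continuousLinearMapAt_symmL (R := ℝ)
    (by simpa using hq) e

/-- At the base point of the chart the components of a tangent vector are the vector itself,
since the fibre of the tangent bundle is by definition the model space. -/
theorem comps_self (p : M) (v : TangentSpace I p) : comps I p p v = v := by
  rw [comps, TangentBundle.continuousLinearMapAt_trivializationAt_eq_core (mem_chart_source H p)]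
  exact (tangentBundleCore I M).coordChange_self (achart H p) p (mem_chart_source H p) v

theorem constExt_self (p : M) (w : TangentSpace I p) : constExt I p w p = w :=
  ofComps_comps (mem_chart_source H p) w

/-- A vector field along a map is differentiable iff the map and the components of the field are. -/
theorem mdifferentiableAt_along_iff {F : N → M} {X : ∀ q, TangentSpace I (F q)} {p : N} :
    MDifferentiableAt J I.tangent (fun q => (⟨F q, X q⟩ : TangentBundle I M)) p ↔
      MDifferentiableAt J I F p ∧
        MDifferentiableAt J 𝓘(ℝ, E) (fun q => comps I (F p) (F q) (X q)) p := by
  rw [mdifferentiableAt_totalSpace]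
  refine and_congr_right fun hF => ?_
  refine Filter.EventuallyEq.mdifferentiableAt_iff ?_
  filter_upwards [hF.continuousAt.preimage_mem_nhds (chart_source_mem_nhds H (F p))] with q hq
  exact (congrFun ((trivializationAt E (TangentSpace I : M → Type _)
    (F p)).coe_linearMapAt_of_mem (R := ℝ) (b := F q) (by simpa using hq)) (X q)).symm

theorem mdifferentiableAt_ofComps (p : M) (e : E) :
    MDifferentiableAt I I.tangent (fun q => (⟨q, ofComps I p q e⟩ : TangentBundle I M)) p := by
  refine mdifferentiableAt_along_iff.2 ⟨mdifferentiableAt_id, ?_⟩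
  refine (mdifferentiableAt_const (c := e)).congr_of_eventuallyEq ?_
  filter_upwards [chart_source_mem_nhds H p] with q hq
  exact comps_ofComps hq e

theorem mdifferentiableAt_constExt (p : M) (w : TangentSpace I p) :
    MDifferentiableAt I I.tangent (fun q => (⟨q, constExt I p w q⟩ : TangentBundle I M)) p :=
  mdifferentiableAt_ofComps p _

variable [RiemannianBundle (fun x : M => TangentSpace I x)]

theorem inner_eq_metricCoeff {p q : M} (hq : q ∈ (chartAt H p).source) (v w : TangentSpace I q) :
    ⟪v, w⟫_ℝ = metricCoeff I p q (comps I p q v) (comps I p q w) := by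
  change _ = ⟪ofComps I p q (comps I p q v), ofComps I p q (comps I p q w)⟫_ℝ
  rw [ofComps_comps hq, ofComps_comps hq]

theorem metricCoeff_symm (p q : M) (a b : E) :
    metricCoeff I p q a b = metricCoeff I p q b a :=
  real_inner_comm (F := TangentSpace I q) _ _

variable [FiniteDimensional ℝ E]

theorem inner_christoffel (p : M) (u v w : TangentSpace I p) :
    ⟪christoffel I p v u, w⟫_ℝ
      = (dMetric I p u v w + dMetric I p v u w - dMetric I p w u v) / 2 :=
  inner_sharp _ _

variable [IsContMDiffRiemannianBundle I ∞ E (fun x : M => TangentSpace I x)]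

theorem mdifferentiableAt_metricCoeff (p : M) :
    MDifferentiableAt I 𝓘(ℝ, E →L[ℝ] E →L[ℝ] ℝ) (metricCoeff I p) p :=
  mdifferentiableAt_clm_of_apply fun a => mdifferentiableAt_clm_of_apply fun b =>
    MDifferentiableAt.inner_bundle (F := E) (E := fun x : M => TangentSpace I x)
      (mdifferentiableAt_ofComps p a) (mdifferentiableAt_ofComps p b)

theorem dMetric_eq (p : M) (u v w : TangentSpace I p) :
    dMetric I p u v w =
      mvfderiv I (fun q => metricCoeff I p q (comps I p p v) (comps I p p w)) p u := by
  rw [mvfderiv_clm_apply ((mdifferentiableAt_metricCoeff p).clm_apply mdifferentiableAt_const)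
    mdifferentiableAt_const, mvfderiv_clm_apply (mdifferentiableAt_metricCoeff p)
    mdifferentiableAt_const]
  simp [mvfderiv_const, dMetric]

theorem dMetric_symm (p : M) (u v w : TangentSpace I p) :
    dMetric I p u v w = dMetric I p u w v := by
  simp_rw [dMetric_eq, metricCoeff_symm _ _ (comps I p p v)]

/-- The Levi-Civita connection is torsion free. -/
theorem christoffel_symm (p : M) (u v : TangentSpace I p) :
    christoffel I p v u = christoffel I p u v := by
  refine ext_inner_right ℝ fun w => ?_
  rw [inner_christoffel, inner_christoffel, dMetric_symm p w u v]
  ring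

/-- Metric compatibility in terms of the Christoffel symbols. -/
theorem dMetric_eq_christoffel (p : M) (u v w : TangentSpace I p) :
    dMetric I p u v w = ⟪christoffel I p v u, w⟫_ℝ + ⟪v, christoffel I p w u⟫_ℝ := by
  rw [real_inner_comm (christoffel I p w u) v, inner_christoffel, inner_christoffel,
    dMetric_symm p u w v]
  ring

/-- Metric compatibility of the Levi-Civita connection for vector fields along a map. -/
theorem mvfderiv_inner_along {F : N → M} {X Z : ∀ q, TangentSpace I (F q)} {p : N}
    (hX : MDifferentiableAt J I.tangent (fun q => (⟨F q, X q⟩ : TangentBundle I M)) p)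
    (hZ : MDifferentiableAt J I.tangent (fun q => (⟨F q, Z q⟩ : TangentBundle I M)) p)
    (v : TangentSpace J p) :
    mvfderiv J (fun q => ⟪X q, Z q⟫_ℝ) p v
      = ⟪covAlong I J F X p v, Z p⟫_ℝ + ⟪X p, covAlong I J F Z p v⟫_ℝ := by
  obtain ⟨hF, hx⟩ := mdifferentiableAt_along_iff.1 hX
  obtain ⟨-, hz⟩ := mdifferentiableAt_along_iff.1 hZ
  have hG : MDifferentiableAt J 𝓘(ℝ, E →L[ℝ] E →L[ℝ] ℝ) (metricCoeff I (F p) ∘ F) p :=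
    (mdifferentiableAt_metricCoeff (F p)).comp p hF
  have hev : (fun q => ⟪X q, Z q⟫_ℝ) =ᶠ[nhds p] fun q =>
      (metricCoeff I (F p) ∘ F) q (comps I (F p) (F q) (X q)) (comps I (F p) (F q) (Z q)) := by
    filter_upwards [hF.continuousAt.preimage_mem_nhds (chart_source_mem_nhds H (F p))] with q hq
    exact inner_eq_metricCoeff hq _ _
  have hd : mvfderiv J (fun q => ⟪X q, Z q⟫_ℝ) p = mvfderiv J (fun q =>
      (metricCoeff I (F p) ∘ F) q (comps I (F p) (F q) (X q)) (comps I (F p) (F q) (Z q))) p :=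
    hev.mfderiv_eq
  have hcomp : mvfderiv J (metricCoeff I (F p) ∘ F) p v
      = mvfderiv I (metricCoeff I (F p)) (F p) (mfderiv J I F p v) :=
    mfderiv_comp_apply p (mdifferentiableAt_metricCoeff (F p)) hF v
  rw [hd, mvfderiv_clm_apply (hG.clm_apply hx) hz, mvfderiv_clm_apply hG hx, hcomp]
  have hD := dMetric_eq_christoffel (F p) (mfderiv J I F p v) (X p) (Z p)
  have hself := mem_chart_source H (F p)
  have h1 : ⟪ofComps I (F p) (F p) (mvfderiv J (fun q => comps I (F p) (F q) (X q)) p v), Z p⟫_ℝ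
      = metricCoeff I (F p) (F p) (mvfderiv J (fun q => comps I (F p) (F q) (X q)) p v)
        (comps I (F p) (F p) (Z p)) := by
    rw [inner_eq_metricCoeff hself, comps_ofComps hself]
  have h2 : ⟪X p, ofComps I (F p) (F p) (mvfderiv J (fun q => comps I (F p) (F q) (Z q)) p v)⟫_ℝ
      = metricCoeff I (F p) (F p) (comps I (F p) (F p) (X p))
        (mvfderiv J (fun q => comps I (F p) (F q) (Z q)) p v) := by
    rw [inner_eq_metricCoeff hself, comps_ofComps hself]
  simp only [covAlong, LinearMap.add_apply, LinearMap.comp_apply, ContinuousLinearMap.coe_coe,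
    inner_add_left, inner_add_right, h1, h2, add_apply, Function.comp_apply]
  rw [dMetric] at hD
  linarith

/-- The Leibniz rule `∇(gY) = g ∇Y + dg ⊗ Y`. -/
theorem cov_smul {g : M → ℝ} {Y : ∀ q : M, TangentSpace I q} {p : M}
    (hg : MDifferentiableAt I 𝓘(ℝ) g p)
    (hY : MDifferentiableAt I I.tangent (fun q => (⟨q, Y q⟩ : TangentBundle I M)) p) :
    cov I (fun q => g q • Y q) p
      = g p • cov I Y p + (mvfderiv I g p).toLinearMap.smulRight (Y p) := by
  have hy := (mdifferentiableAt_along_iff.1 hY).2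
  ext v
  simp only [cov, covAlong, LinearMap.add_apply, LinearMap.comp_apply, ContinuousLinearMap.coe_coe,
    map_smul, LinearMap.smul_apply, LinearMap.smulRight_apply]
  rw [mvfderiv_fun_smul hg hy, christoffel_symm p (mfderiv I I (fun q => q) p v) (g p • Y p),
    christoffel_symm p (mfderiv I I (fun q => q) p v) (Y p)]
  simp only [add_apply, smul_apply, ContinuousLinearMap.smulRight_apply, map_add, map_smul,
    ofComps_comps (mem_chart_source H p), smul_add]
  abel

/-- `div_f Z = div Z - ⟪∇f, Z⟫`. -/
theorem weightedDivergence_eq {f : M → ℝ} {Z : ∀ q : M, TangentSpace I q} {p : M}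
    (hf : MDifferentiableAt I 𝓘(ℝ) f p)
    (hZ : MDifferentiableAt I I.tangent (fun q => (⟨q, Z q⟩ : TangentBundle I M)) p) :
    weightedDivergence I f Z p = divergence I Z p - ⟪grad I f p, Z p⟫_ℝ := by
  have he : HasDerivAt (fun t : ℝ => Real.exp (-t)) (-Real.exp (-f p)) (f p) := by
    simpa using (hasDerivAt_neg (f p)).exp
  have hg : MDifferentiableAt I 𝓘(ℝ) (fun q => Real.exp (-f q)) p :=
    he.differentiableAt.comp_mdifferentiableAt hf
  have hd : mvfderiv I (fun q => Real.exp (-f q)) p (Z p)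
      = -Real.exp (-f p) * mvfderiv I f p (Z p) := by
    have h := (he.hasFDerivAt.hasMFDerivAt.comp p hf.hasMFDerivAt).mfderiv
    refine congr($h (Z p)).trans ?_
    change mvfderiv I f p (Z p) * -Real.exp (-f p) = _
    exact mul_comm _ _
  have hs : ⟪grad I f p, Z p⟫_ℝ = mvfderiv I f p (Z p) := inner_sharp _ _
  rw [weightedDivergence, divergence, cov_smul hg hZ, map_add, map_smul, LinearMap.trace_smulRight,
    ContinuousLinearMap.coe_coe, hd, hs, divergence, smul_eq_mul]
  have : Real.exp (f p) * Real.exp (-f p) = 1 := by rw [← Real.exp_add]; simp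
  linear_combination (LinearMap.trace ℝ (TangentSpace I p) (cov I Z p)
    - mvfderiv I f p (Z p)) * this

end Connection

/-! ### The differential of a smooth map in coordinates -/

section PushForward

variable {E : Type*} [NormedAddCommGroup E] [NormedSpace ℝ E]
  {H : Type*} [TopologicalSpace H] {I : ModelWithCorners ℝ E H}
  {M : Type*} [TopologicalSpace M] [ChartedSpace H M] [IsManifold I ∞ M]
  {E' : Type*} [NormedAddCommGroup E'] [NormedSpace ℝ E']
  {H' : Type*} [TopologicalSpace H'] {I' : ModelWithCorners ℝ E' H'}
  {M' : Type*} [TopologicalSpace M'] [ChartedSpace H' M'] [IsManifold I' ∞ M']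

/-- The differential of a smooth map sends differentiable vector fields to differentiable
vector fields along the map. -/
theorem mdifferentiableAt_mfderiv_apply {ι : M → M'} (hι : ContMDiff I I' ∞ ι)
    {W : ∀ q : M, TangentSpace I q} {p : M}
    (hW : MDifferentiableAt I I.tangent (fun q => (⟨q, W q⟩ : TangentBundle I M)) p) :
    MDifferentiableAt I I'.tangent
      (fun q => (⟨ι q, mfderiv I I' ι q (W q)⟩ : TangentBundle I' M')) p := by
  have h : ContMDiffAt I 𝓘(ℝ, E →L[ℝ] E') 1
      (inTangentCoordinates I I' id ι (mfderiv I I' ι) p) p :=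
    (hι.contMDiffAt).mfderiv_const (by norm_cast)
  exact MDifferentiableAt.clm_apply_of_inCoordinates (h.mdifferentiableAt one_ne_zero) hW
    (hι.mdifferentiableAt (by simp))

/-- In the charts at `p` and `ι p`, the components of the image of a coordinate vector field are
the partial derivatives of the coordinate expression of `ι`. -/
theorem comps_mfderiv_constExt {ι : M → M'} (hι : ContMDiff I I' ∞ ι) (p : M)
    (w : TangentSpace I p) {y : E} (hy : y ∈ (extChartAt I p).target)
    (hy' : ι ((extChartAt I p).symm y) ∈ (chartAt H' (ι p)).source) :
    comps I' (ι p) (ι ((extChartAt I p).symm y))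
        (mfderiv I I' ι ((extChartAt I p).symm y) (constExt I p w ((extChartAt I p).symm y)))
      = fderivWithin ℝ (writtenInExtChartAt I I' p ι) (Set.range I) y w := by
  have hq : (extChartAt I p).symm y ∈ (chartAt H p).source := by
    simpa using (extChartAt I p).map_target hy
  have hyr : y ∈ Set.range I := extChartAt_target_subset_range p hy
  have hu : UniqueMDiffWithinAt 𝓘(ℝ, E) (Set.range I) y :=
    (I.uniqueDiffOn y hyr).uniqueMDiffWithinAt
  have hsymm : MDifferentiableWithinAt 𝓘(ℝ, E) I (extChartAt I p).symm (Set.range I) y :=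
    mdifferentiableWithinAt_extChartAt_symm hy
  have hι' : MDifferentiableAt I I' ι ((extChartAt I p).symm y) :=
    hι.mdifferentiableAt (by simp)
  have hext : MDifferentiableAt I' 𝓘(ℝ, E') (extChartAt I' (ι p)) (ι ((extChartAt I p).symm y)) :=
    mdifferentiableAt_extChartAt hy'
  rw [constExt, comps_self, comps, ofComps,
    TangentBundle.continuousLinearMapAt_trivializationAt hy',
    TangentBundle.symmL_trivializationAt hq, (extChartAt I p).right_inv hy,
    ← mfderivWithin_eq_fderivWithin]
  have h1 := mfderiv_comp_mfderivWithin y (hext.comp _ hι') hsymm hu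
  have h2 := mfderiv_comp ((extChartAt I p).symm y) hext hι'
  rw [h2] at h1
  exact (congr($h1 w)).symm

/-- Second partial derivatives commute: the coordinate derivatives of `dι W` in the direction
`v` and of `dι V` in the direction `w` agree for coordinate vector fields `V`, `W`. -/
theorem mvfderiv_comps_mfderiv_constExt_symm {ι : M → M'} (hι : ContMDiff I I' ∞ ι) (p : M)
    (v w : TangentSpace I p) :
    mvfderiv I (fun q => comps I' (ι p) (ι q) (mfderiv I I' ι q (constExt I p w q))) p v
      = mvfderiv I (fun q => comps I' (ι p) (ι q) (mfderiv I I' ι q (constExt I p v q))) p w := by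
  have hF : ContDiffWithinAt ℝ 2 (writtenInExtChartAt I I' p ι) (Set.range I) (extChartAt I p p) :=
    ((contMDiffAt_iff.1 hι.contMDiffAt).2).of_le (by norm_cast)
  have hp : extChartAt I p p ∈ Set.range I := Set.mem_range_self _
  -- Both sides are the second derivative of the coordinate expression of `ι` within `range I`; its
  -- symmetry persists at boundary points, which are limits of interior points.
  have key : ∀ a b : TangentSpace I p,
      mvfderiv I (fun q => comps I' (ι p) (ι q) (mfderiv I I' ι q (constExt I p b q))) p a
        = fderivWithin ℝ (fderivWithin ℝ (writtenInExtChartAt I I' p ι) (Set.range I))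
          (Set.range I) (extChartAt I p p) a b := by
    intro a b
    have hd := (mdifferentiableAt_along_iff.1
      (mdifferentiableAt_mfderiv_apply hι (mdifferentiableAt_constExt p b))).2
    have hev : writtenInExtChartAt I 𝓘(ℝ, E') p
        (fun q => comps I' (ι p) (ι q) (mfderiv I I' ι q (constExt I p b q)))
        =ᶠ[nhdsWithin (extChartAt I p p) (Set.range I)]
        fun y => fderivWithin ℝ (writtenInExtChartAt I I' p ι) (Set.range I) y b := by
      have hsrc : ∀ᶠ y in nhdsWithin (extChartAt I p p) (Set.range I),
          ι ((extChartAt I p).symm y) ∈ (chartAt H' (ι p)).source := by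
        have hc : ContinuousAt (fun y => ι ((extChartAt I p).symm y)) (extChartAt I p p) :=
          hι.continuous.continuousAt.comp (continuousAt_extChartAt_symm p)
        refine nhdsWithin_le_nhds (hc.preimage_mem_nhds ?_)
        rw [extChartAt_to_inv]
        exact chart_source_mem_nhds H' (ι p)
      filter_upwards [hsrc, extChartAt_target_mem_nhdsWithin p] with y hy' hy
      exact comps_mfderiv_constExt hι p b hy hy'
    have hdd : DifferentiableWithinAt ℝ
        (fderivWithin ℝ (writtenInExtChartAt I I' p ι) (Set.range I))
        (Set.range I) (extChartAt I p p) :=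
      (hF.fderivWithin_right I.uniqueDiffOn (m := 1) (by norm_num) hp).differentiableWithinAt
        one_ne_zero
    have happ : ∀ e e' : E, fderivWithin ℝ
        (fun y => fderivWithin ℝ (writtenInExtChartAt I I' p ι) (Set.range I) y e')
        (Set.range I) (extChartAt I p p) e
        = fderivWithin ℝ (fderivWithin ℝ (writtenInExtChartAt I I' p ι) (Set.range I))
          (Set.range I) (extChartAt I p p) e e' := by
      intro e e'
      rw [fderivWithin_clm_apply (I.uniqueDiffOn _ hp) hdd (differentiableWithinAt_const _)]
      simp
    rw [hd.mvfderiv, hev.fderivWithin_eq_of_mem hp]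
    exact happ a b
  rw [key, key]
  exact hF.isSymmSndFDerivWithinAt (by simp) I.uniqueDiffOn
    (I.range_subset_closure_interior hp) hp v w

end PushForward

/-! ### The second fundamental form and the tangential part -/

section Hypersurface

variable {E : Type*} [NormedAddCommGroup E] [NormedSpace ℝ E]
  {H : Type*} [TopologicalSpace H] {I : ModelWithCorners ℝ E H}
  {M : Type*} [TopologicalSpace M] [ChartedSpace H M]
  [RiemannianBundle (fun x : M => TangentSpace I x)]
  {E' : Type*} [NormedAddCommGroup E'] [NormedSpace ℝ E'] [FiniteDimensional ℝ E']
  {H' : Type*} [TopologicalSpace H'] {I' : ModelWithCorners ℝ E' H'}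
  {M' : Type*} [TopologicalSpace M'] [ChartedSpace H' M']
  [RiemannianBundle (fun x : M' => TangentSpace I' x)]

/-- In codimension one every normal vector is a multiple of the unit normal. -/
theorem IsIsometricImmersion.eq_smul_of_normal {ι : M → M'} (hι : IsIsometricImmersion I I' ι)
    (hdim : Module.finrank ℝ E' = Module.finrank ℝ E + 1) {p : M} {η n : TangentSpace I' (ι p)}
    (hη_unit : ‖η‖ = 1) (hη : ∀ v : TangentSpace I p, ⟪η, mfderiv I I' ι p v⟫_ℝ = 0)
    (hn : ∀ v : TangentSpace I p, ⟪n, mfderiv I I' ι p v⟫_ℝ = 0) :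
    n = ⟪η, n⟫_ℝ • η := by
  let K := LinearMap.range (mfderiv I I' ι p).toLinearMap
  have hinj : Function.Injective (mfderiv I I' ι p).toLinearMap := by
    rw [injective_iff_map_eq_zero]
    intro v hv
    have h := hι.inner_mfderiv p v v
    have hv' : mfderiv I I' ι p v = 0 := hv
    rw [hv', inner_zero_left] at h
    exact inner_self_eq_zero.1 h.symm
  have hK : Module.finrank ℝ K = Module.finrank ℝ E := LinearMap.finrank_range_of_inj hinj
  have hmem : ∀ x : TangentSpace I' (ι p), (∀ v, ⟪x, mfderiv I I' ι p v⟫_ℝ = 0) → x ∈ Kᗮ := by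
    intro x hx
    rw [Submodule.mem_orthogonal']
    rintro _ ⟨v, rfl⟩
    exact hx v
  have hperp : Module.finrank ℝ Kᗮ = 1 := by
    have h := K.finrank_add_finrank_orthogonal
    have h' : Module.finrank ℝ (TangentSpace I' (ι p)) = Module.finrank ℝ E' := rfl
    omega
  have hne : (⟨η, hmem η hη⟩ : Kᗮ) ≠ 0 := by
    intro h
    have : η = 0 := congrArg Subtype.val h
    simp [this] at hη_unit
  obtain ⟨c, hc⟩ := (finrank_eq_one_iff_of_nonzero' _ hne).1 hperp ⟨n, hmem n hn⟩
  have hc' : c • η = n := congrArg Subtype.val hc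
  rw [← hc', real_inner_smul_right, real_inner_self_eq_norm_sq, hη_unit]
  simp

variable [FiniteDimensional ℝ E]

theorem inner_tangential (ι : M → M') (p : M) (X : TangentSpace I' (ι p)) (v : TangentSpace I p) :
    ⟪tangential I I' ι p X, v⟫_ℝ = ⟪X, mfderiv I I' ι p v⟫_ℝ :=
  LinearMap.adjoint_inner_left _ _ _

variable [IsManifold I ∞ M]

/-- Nondegeneracy of the metric, which in finite dimension makes the metric an isomorphism onto
the dual. -/
theorem isInvertible_metricCoeff (p : M) : (metricCoeff I p p).IsInvertible := by
  have hinj : Function.Injective (metricCoeff I p p) := by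
    rw [injective_iff_map_eq_zero]
    intro e he
    have h : ⟪ofComps I p p e, ofComps I p p e⟫_ℝ = 0 := congr($he e)
    rw [← comps_ofComps (I := I) (mem_chart_source H p) e, inner_self_eq_zero.1 h, map_zero]
  have hdim : Module.finrank ℝ E = Module.finrank ℝ (E →L[ℝ] ℝ) := by
    rw [← (LinearMap.toContinuousLinearMap (𝕜 := ℝ) (E := E) (F' := ℝ)).finrank_eq]
    exact (Subspace.dual_finrank_eq (K := ℝ) (V := E)).symm
  exact ⟨(LinearEquiv.ofInjectiveOfFinrankEq (metricCoeff I p p).toLinearMap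
    hinj hdim).toContinuousLinearEquiv, by ext; rfl⟩

variable [IsContMDiffRiemannianBundle I ∞ E (fun x : M => TangentSpace I x)]

/-- A vector field is differentiable if its inner products with the coordinate vector fields
are: its components solve a linear system whose matrix is the metric. -/
theorem mdifferentiableAt_of_inner_ofComps {Y : ∀ q : M, TangentSpace I q} {p : M}
    (h : ∀ e : E, MDifferentiableAt I 𝓘(ℝ) (fun q => ⟪Y q, ofComps I p q e⟫_ℝ) p) :
    MDifferentiableAt I I.tangent (fun q => (⟨q, Y q⟩ : TangentBundle I M)) p := by
  have : CompleteSpace E := FiniteDimensional.complete ℝ E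
  refine mdifferentiableAt_along_iff.2 ⟨mdifferentiableAt_id, ?_⟩
  have hl : MDifferentiableAt I 𝓘(ℝ, E →L[ℝ] ℝ)
      (fun q => (innerSL ℝ (Y q)).comp (ofComps I p q)) p :=
    mdifferentiableAt_clm_of_apply h
  have hG := mdifferentiableAt_metricCoeff (I := I) p
  have hinv : MDifferentiableAt I 𝓘(ℝ, (E →L[ℝ] ℝ) →L[ℝ] E)
      (fun q => (metricCoeff I p q).inverse) p :=
    ((isInvertible_metricCoeff p).contDiffAt_map_inverse (n := 1)).differentiableAt
      one_ne_zero |>.comp_mdifferentiableAt hG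
  refine (hinv.clm_apply hl).congr_of_eventuallyEq ?_
  have hopen : ∀ᶠ q in nhds p, (metricCoeff I p q).IsInvertible := by
    obtain ⟨g, hg⟩ := isInvertible_metricCoeff (I := I) p
    exact hG.continuousAt.eventually (hg ▸ g.nhds)
  filter_upwards [hopen, chart_source_mem_nhds H p] with q hq hqs
  have : (innerSL ℝ (Y q)).comp (ofComps I p q) = metricCoeff I p q (comps I p q (Y q)) := by
    ext e
    change ⟪Y q, ofComps I p q e⟫_ℝ = _
    rw [inner_eq_metricCoeff hqs, comps_ofComps hqs]
  rw [this]
  exact (hq.inverse_apply_self _).symm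

variable [IsManifold I' ∞ M']
  [IsContMDiffRiemannianBundle I' ∞ E' (fun x : M' => TangentSpace I' x)]

theorem mdifferentiableAt_tangential {ι : M → M'} (hι : ContMDiff I I' ∞ ι)
    {X : ∀ p : M, TangentSpace I' (ι p)} {p : M}
    (hX : MDifferentiableAt I I'.tangent (fun q => (⟨ι q, X q⟩ : TangentBundle I' M')) p) :
    MDifferentiableAt I I.tangent
      (fun q => (⟨q, tangential I I' ι q (X q)⟩ : TangentBundle I M)) p := by
  refine mdifferentiableAt_of_inner_ofComps fun e => ?_
  simp_rw [inner_tangential]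
  exact MDifferentiableAt.inner_bundle (F := E') (E := fun x : M' => TangentSpace I' x) hX
    (mdifferentiableAt_mfderiv_apply hι (mdifferentiableAt_ofComps p e))

/-- Symmetry of the second fundamental form: coordinate vector fields commute, and the
connections are torsion free. -/
theorem secondFundamentalForm_symm {ι : M → M'} (hι : ContMDiff I I' ∞ ι) (p : M)
    (v w : TangentSpace I p) :
    secondFundamentalForm I I' ι p w v = secondFundamentalForm I I' ι p v w := by
  -- The components of a coordinate field are constant near `p`, so only the Christoffel term of
  -- its covariant derivative survives.
  have h : ∀ a b : TangentSpace I p, cov I (constExt I p b) p a = christoffel I p b a := by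
    intro a b
    have hz : mvfderiv I (fun q => comps I p q (constExt I p b q)) p = 0 := by
      have hev : (fun q => comps I p q (constExt I p b q)) =ᶠ[nhds p]
          fun _ => comps I p p b := by
        filter_upwards [chart_source_mem_nhds H p] with q hq
        exact comps_ofComps hq _
      have hd : mvfderiv I (fun q => comps I p q (constExt I p b q)) p
          = mvfderiv I (fun _ : M => comps I p p b) p := hev.mfderiv_eq
      rw [hd, mvfderiv_const]
    have hid : mfderiv I I (fun q : M => q) p = ContinuousLinearMap.id ℝ _ := mfderiv_id
    simp only [cov, covAlong, LinearMap.add_apply, LinearMap.comp_apply, hz, hid, constExt_self]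
    simp
  simp only [secondFundamentalForm, LinearMap.sub_apply, LinearMap.comp_apply, h, covAlong,
    LinearMap.add_apply, ContinuousLinearMap.coe_coe, constExt_self]
  rw [mvfderiv_comps_mfderiv_constExt_symm hι, christoffel_symm p v w,
    christoffel_symm (ι p) (mfderiv I I' ι p v)]

/-- Gauss' formula: the second fundamental form takes normal values. The form
`⟪B(v, w), dι u⟫` is symmetric in `v, w` and skew in `w, u`. -/
theorem IsIsometricImmersion.inner_secondFundamentalForm {ι : M → M'}
    (hι : IsIsometricImmersion I I' ι) (p : M) (u v w : TangentSpace I p) :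
    ⟪secondFundamentalForm I I' ι p w v, mfderiv I I' ι p u⟫_ℝ = 0 := by
  -- Compare the derivatives of the equal functions `⟪b, c⟫` and `⟪dι b, dι c⟫`.
  have hskew : ∀ a b c : TangentSpace I p,
      ⟪secondFundamentalForm I I' ι p b a, mfderiv I I' ι p c⟫_ℝ
        = - ⟪secondFundamentalForm I I' ι p c a, mfderiv I I' ι p b⟫_ℝ := by
    intro a b c
    have hb := mdifferentiableAt_constExt p b
    have hc := mdifferentiableAt_constExt p c
    have h1 := mvfderiv_inner_along hb hc a
    have h2 := mvfderiv_inner_along (mdifferentiableAt_mfderiv_apply hι.contMDiff hb)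
      (mdifferentiableAt_mfderiv_apply hι.contMDiff hc) a
    simp_rw [hι.inner_mfderiv] at h2
    rw [h1] at h2
    simp only [constExt_self] at h2
    simp only [secondFundamentalForm, LinearMap.sub_apply, LinearMap.comp_apply,
      ContinuousLinearMap.coe_coe, inner_sub_left, hι.inner_mfderiv]
    rw [real_inner_comm (covAlong I' I ι _ p a) (mfderiv I I' ι p b),
      real_inner_comm (covAlong I I (fun q => q) (constExt I p c) p a) b] at h2
    unfold cov
    linarith
  -- A trilinear form symmetric in one pair of slots and skew in an overlapping pair is zero.
  have h1 := hskew v w u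
  have h2 := hskew u v w
  have h3 := hskew w u v
  rw [secondFundamentalForm_symm hι.contMDiff p v u] at h1
  rw [secondFundamentalForm_symm hι.contMDiff p u w] at h2
  rw [secondFundamentalForm_symm hι.contMDiff p w v] at h3
  linarith

/-- The defining property `⟪A v, w⟫ = ⟪ν, B(v, w)⟫` of the Weingarten operator. -/
theorem inner_weingarten {ι : M → M'} (hι : ContMDiff I I' ∞ ι) (p : M)
    (ν : TangentSpace I' (ι p)) (v w : TangentSpace I p) :
    ⟪weingarten I I' ι p ν v, w⟫_ℝ = ⟪ν, secondFundamentalForm I I' ι p w v⟫_ℝ := by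
  have hw := (stdOrthonormalBasis ℝ (TangentSpace I p)).sum_repr' w
  -- Only linearity in `v` is built into `secondFundamentalForm`; linearity in `w`, needed to expand
  -- `w` in the orthonormal basis, comes from symmetry.
  rw [secondFundamentalForm_symm hι p v w]
  conv_rhs => rw [← hw]
  rw [map_sum, inner_sum, weingarten, LinearMap.sum_apply, sum_inner]
  refine Finset.sum_congr rfl fun i _ => ?_
  rw [LinearMap.smulRight_apply, real_inner_smul_left, map_smul, real_inner_smul_right,
    secondFundamentalForm_symm hι p _ v, mul_comm]
  rfl

/-- The covariant derivative of the tangential part: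
`∇_v X^⊤ = (∇'_v X)^⊤ + ⟪X, η⟫ A v`. -/
theorem IsIsometricImmersion.cov_tangential {ι : M → M'} (hι : IsIsometricImmersion I I' ι)
    (hdim : Module.finrank ℝ E' = Module.finrank ℝ E + 1) {p : M} {η : TangentSpace I' (ι p)}
    (hη_unit : ‖η‖ = 1) (hη : ∀ v : TangentSpace I p, ⟪η, mfderiv I I' ι p v⟫_ℝ = 0)
    {X : ∀ q : M, TangentSpace I' (ι q)}
    (hX : MDifferentiableAt I I'.tangent (fun q => (⟨ι q, X q⟩ : TangentBundle I' M')) p) :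
    cov I (fun q => tangential I I' ι q (X q)) p
      = tangential I I' ι p ∘ₗ covAlong I' I ι X p + ⟪X p, η⟫_ℝ • weingarten I I' ι p η := by
  refine LinearMap.ext fun v => ext_inner_right ℝ fun w => ?_
  have hW := mdifferentiableAt_constExt p w
  have h1 := mvfderiv_inner_along (mdifferentiableAt_tangential hι.contMDiff hX) hW v
  have h2 := mvfderiv_inner_along hX (mdifferentiableAt_mfderiv_apply hι.contMDiff hW) v
  simp_rw [inner_tangential] at h1
  rw [h2] at h1
  simp only [constExt_self] at h1
  -- As `B` is a multiple of `η`, only the `η`-component of `X` contributes.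
  have hB : ⟪X p, secondFundamentalForm I I' ι p w v⟫_ℝ
      = ⟪X p, η⟫_ℝ * ⟪η, secondFundamentalForm I I' ι p w v⟫_ℝ := by
    conv_lhs => rw [hι.eq_smul_of_normal hdim hη_unit hη
      (fun u => hι.inner_secondFundamentalForm p u v w)]
    rw [real_inner_smul_right, mul_comm]
  rw [LinearMap.add_apply, inner_add_left, LinearMap.comp_apply, inner_tangential,
    LinearMap.smul_apply, real_inner_smul_left, inner_weingarten hι.contMDiff, ← hB,
    secondFundamentalForm, LinearMap.sub_apply, inner_sub_right, LinearMap.comp_apply,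
    ContinuousLinearMap.coe_coe]
  unfold cov
  linarith

end Hypersurface

end HypersurfaceDiv

theorem mainTheorem11 {m : ℕ} (hm : 2 ≤ m)
    {E : Type*} [NormedAddCommGroup E] [NormedSpace ℝ E] [FiniteDimensional ℝ E]
    {H : Type*} [TopologicalSpace H] (I : ModelWithCorners ℝ E H)
    {M : Type*} [TopologicalSpace M] [ChartedSpace H M] [IsManifold I ∞ M]
    [RiemannianBundle (fun x : M => TangentSpace I x)]
    [IsContMDiffRiemannianBundle I ∞ E (fun x : M => TangentSpace I x)]
    {E' : Type*} [NormedAddCommGroup E'] [NormedSpace ℝ E'] [FiniteDimensional ℝ E']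
    {H' : Type*} [TopologicalSpace H'] (I' : ModelWithCorners ℝ E' H')
    {M' : Type*} [TopologicalSpace M'] [ChartedSpace H' M'] [IsManifold I' ∞ M']
    [RiemannianBundle (fun x : M' => TangentSpace I' x)]
    [IsContMDiffRiemannianBundle I' ∞ E' (fun x : M' => TangentSpace I' x)]
    (hE : Module.finrank ℝ E = m) (hE' : Module.finrank ℝ E' = m + 1)
    (ι : M → M') (hι : HypersurfaceDiv.IsIsometricImmersion I I' ι)
    (η : ∀ p : M, TangentSpace I' (ι p))
    (hη_unit : ∀ p : M, ‖η p‖ = 1)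
    (hη_normal : ∀ (p : M) (v : TangentSpace I p), ⟪η p, mfderiv I I' ι p v⟫_ℝ = 0)
    (X : ∀ p : M, TangentSpace I' (ι p))
    (hX : ContMDiff I I'.tangent 1 (fun p => (⟨ι p, X p⟩ : TangentBundle I' M')))
    (T : ∀ p : M, TangentSpace I p →L[ℝ] TangentSpace I p)
    (hT : ContMDiff I (I.prod 𝓘(ℝ, E →L[ℝ] E)) 1
      (fun p => TotalSpace.mk' (E →L[ℝ] E)
        (E := fun x : M => TangentSpace I x →L[ℝ] TangentSpace I x) p (T p)))
    (hT_symm : ∀ (p : M) (u v : TangentSpace I p), ⟪T p u, v⟫_ℝ = ⟪u, T p v⟫_ℝ)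
    (f : M → ℝ) (hf : ContMDiff I 𝓘(ℝ) 1 f) (p : M) :
    HypersurfaceDiv.weightedDivergence I f
        (fun q => T q (HypersurfaceDiv.tangential I I' ι q (X q))) p =
      - ⟪HypersurfaceDiv.tangential I I' ι p (X p), T p (HypersurfaceDiv.grad I f p)⟫_ℝ
      + LinearMap.trace ℝ (TangentSpace I p)
          ((T p).toLinearMap ∘ₗ HypersurfaceDiv.tangential I I' ι p ∘ₗ
            HypersurfaceDiv.covAlong I' I ι X p)
      + ⟪X p, η p⟫_ℝ * LinearMap.trace ℝ (TangentSpace I p)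
          (HypersurfaceDiv.weingarten I I' ι p (η p) ∘ₗ (T p).toLinearMap)
      + HypersurfaceDiv.divEnd I T
          (fun q => HypersurfaceDiv.tangential I I' ι q (X q)) p := by
  have hXp := hX.mdifferentiableAt one_ne_zero (x := p)
  have hY := HypersurfaceDiv.mdifferentiableAt_tangential hι.contMDiff hXp
  have hTY := (hT.mdifferentiableAt one_ne_zero (x := p)).clm_bundle_apply hY
  rw [HypersurfaceDiv.weightedDivergence_eq (hf.mdifferentiableAt one_ne_zero) hTY,
    HypersurfaceDiv.divEnd, HypersurfaceDiv.covEnd, map_sub,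
    hι.cov_tangential (by omega) (hη_unit p) (hη_normal p) hXp, LinearMap.comp_add,
    LinearMap.comp_smul, map_add, map_smul, LinearMap.trace_comp_comm' (T p).toLinearMap,
    ← hT_symm, real_inner_comm, HypersurfaceDiv.divergence, smul_eq_mul]
  ring
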